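/- **Theorem.** Let $\mathcal H$ be a complex Hilbert space and let $\mathbf A=(A_1,\dots,A_m)$ be an $m$-tuple of compact linear operators on $\mathcal H$. For $k\ge 1$ put $$W_k(\mathbf A)=\Big\{\Big(\sum_{\ell=1}^k\langle A_1x_\ell,x_\ell\rangle,\dots,\sum_{\ell=1}^k\langle A_mx_\ell,x_\ell\rangle\Big):\ \{x_1,\dots,x_k\}\subseteq\mathcal H\ \text{orthonormal}\Big\}\subseteq\mathbb C^m .$$ A point $\mu=(\mu^{(1)},\dots,\mu^{(m)})\in\mathbb C^m$ is a joint eigenvalue of $\mathbf A$ with common eigenvector $x\neq 0$ if $A_jx=\mu^{(j)}x$ for $j=1,\dots,m$. Let $\Sigma_k(\mathbf A)$ be the set of all sums $\mu_1+\cdots+\mu_k$ of joint eigenvalues $\mu_1,\dots,\mu_k$ of $\mathbf A$ that correspond to $k$ linearly independent common eigenvectors $x_1,\dots,x_k$. (Both sets are empty if $k>\dim\mathcal H$.) Then $\{A_1,\dots,A_m\}$ is a commuting family of normal operators if and only if $$W_k(\mathbf A)=\operatorname{conv}\Sigma_k(\mathbf A)\qquad\text{for all } k\ge 1 .$$ The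 same equivalence holds if $k$ is only required to range over the integers with $1\le k<\dim\mathcal H$. -/

import Mathlib

/-- The joint `k`-numerical range `W_k(A)`: all
`(∑ ℓ, ⟨A 1 x_ℓ, x_ℓ⟩, …, ∑ ℓ, ⟨A m x_ℓ, x_ℓ⟩)` for orthonormal `x_1, …, x_k`. Mathlib's inner
product is linear in its second argument, so `⟨T x, x⟩` reads `inner ℂ x (T x)`. -/
def jointNumericalRange {H : Type*} [NormedAddCommGroup H] [InnerProductSpace ℂ H] {m : ℕ}
    (k : ℕ) (A : Fin m → H →L[ℂ] H) : Set (Fin m → ℂ) :=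
  {a | ∃ x : Fin k → H, Orthonormal ℂ x ∧ ∀ i, a i = ∑ l, inner ℂ (x l) (A i (x l))}

/-- `x` is a common eigenvector of `A` corresponding to the joint eigenvalue `μ`. -/
def IsCommonEigenvector {H : Type*} [NormedAddCommGroup H] [InnerProductSpace ℂ H] {m : ℕ}
    (A : Fin m → H →L[ℂ] H) (μ : Fin m → ℂ) (x : H) : Prop :=
  x ≠ 0 ∧ ∀ i, A i x = μ i • x

/-- `Σ_k(A)`: all sums `μ_1 + ⋯ + μ_k` of joint eigenvalues of `A` corresponding to `k` linearly
independent common eigenvectors. -/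
def jointEigenvalueSums {H : Type*} [NormedAddCommGroup H] [InnerProductSpace ℂ H] {m : ℕ}
    (k : ℕ) (A : Fin m → H →L[ℂ] H) : Set (Fin m → ℂ) :=
  {s | ∃ (μ : Fin k → Fin m → ℂ) (x : Fin k → H), LinearIndependent ℂ x ∧
    (∀ l, IsCommonEigenvector A (μ l) (x l)) ∧ s = ∑ l, μ l}

/-- The operators `A 1, …, A m` are normal and commute pairwise. -/
def IsCommutingNormalFamily {H : Type*} [NormedAddCommGroup H] [InnerProductSpace ℂ H]
    [CompleteSpace H] {m : ℕ} (A : Fin m → H →L[ℂ] H) : Prop :=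
  (∀ i, IsStarNormal (A i)) ∧ ∀ i j, Commute (A i) (A j)

/-! Forward: a commuting compact normal family is diagonal in an orthonormal basis `b`. The diagonal
of a rank-`k` projection has entries in `[0, 1]` and total mass `k`, so `W_k` consists of weighted
sums of joint eigenvalues (`jointNumericalRange_eq_weightedSums`). Every such sum is attained: an
infinite weight can be replaced by a finitely supported one with the same mass and sum
(`exists_finset_sum_eq_and_sum_smul_eq`), and finite weights are realised by plane rotations
(`exists_orthonormal_projectionDiagonal_eq`). Since finite weights are mixtures of indicators of
`k`-sets, the sums lie in the convex hull of `Σ_k`.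

Reverse: put `C = ∑ i, w i • A i` and let `k` count the eigenvalues of `C + star C` above a positive
threshold. A real linear functional on the convex hull is dominated at a point of `Σ_k`, so some `k`
common eigenvectors attain the Ky Fan maximum of `C + star C` and span its top eigenspaces. These
are therefore `C`-invariant (`inner_apply_eq_zero_of_lt`), which forces `C` to commute with `C +
star C`. Thus all combinations are normal, and polarisation with Fuglede's theorem gives
commutativity. -/

open Module Filter Topology

/-! ### Compact operators -/

section Compact
variable {H : Type*} [NormedAddCommGroup H] [InnerProductSpace ℂ H]

/-- Schauder's theorem for Hilbert spaces: the adjoint of a compact operator is compact. -/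
theorem IsCompactOperator.star_clm [CompleteSpace H] {A : H →L[ℂ] H} (hA : IsCompactOperator A) :
    IsCompactOperator (star A : H →L[ℂ] H) := by
  have hAA : IsCompactOperator (A ∘L star A) := hA.comp_clm (star A)
  have hK := (hAA.isCompact_closure_image_closedBall 1).totallyBounded.subset subset_closure
  refine (isCompactOperator_iff_isCompact_closure_image_closedBall
    ((star A : H →L[ℂ] H) : H →ₗ[ℂ] H) zero_lt_one).2 ?_
  refine (TotallyBounded.closure ?_).isCompact_of_isClosed isClosed_closure
  rw [Metric.totallyBounded_iff]
  intro ε hε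
  -- The net has its centres in the image, so they pull back to the unit ball. Since `‖A* u‖² ≤ ‖A
  -- A* u‖ ‖u‖` and `‖x - y‖ ≤ 2`, radius `ε ^ 2 / 2` for `A A*` gives radius `ε` for `A*`.
  obtain ⟨k, hkK, hk, hcov⟩ := hK.exists_subset (Metric.dist_mem_uniformity (half_pos (pow_pos hε 2)))
  obtain ⟨t, ht, htf, hcov⟩ := Set.exists_subset_image_finite_and
    (p := fun k => (A ∘L star A) '' Metric.closedBall 0 1 ⊆
      ⋃ y ∈ k, {x | (x, y) ∈ {p : H × H | dist p.1 p.2 < ε ^ 2 / 2}}).1 ⟨k, hkK, hk, hcov⟩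
  refine ⟨(star A : H →L[ℂ] H) '' t, htf.image _, ?_⟩
  rintro _ ⟨x, hx, rfl⟩
  have := hcov ⟨x, hx, rfl⟩
  simp only [Set.mem_image, Set.iUnion_exists, Set.biUnion_and', Set.iUnion_iUnion_eq_right,
    Set.mem_iUnion, Set.mem_ofPred_eq, exists_prop] at this ⊢
  obtain ⟨y, hy, hxy⟩ := this
  refine ⟨y, hy, ?_⟩
  have hx1 : ‖x‖ ≤ 1 := by simpa using hx
  have hy1 : ‖y‖ ≤ 1 := by simpa using ht hy
  have h2 : ‖x - y‖ ≤ 2 := (norm_sub_le x y).trans (by linarith)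
  have e1 : ‖(star A) (x - y)‖ ^ 2 ≤ ‖A (star A (x - y))‖ * ‖x - y‖ := by
    have : inner ℂ (A (star A (x - y))) (x - y) = inner ℂ (star A (x - y)) (star A (x - y)) := by
      rw [ContinuousLinearMap.star_eq_adjoint, ContinuousLinearMap.adjoint_inner_right]
    rw [inner_self_eq_norm_sq_to_K] at this
    have h3 := norm_inner_le_norm (𝕜 := ℂ) (A (star A (x - y))) (x - y)
    rw [this] at h3
    simpa using h3
  have e2 : ‖A (star A (x - y))‖ < ε ^ 2 / 2 := by
    simpa [dist_eq_norm] using hxy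
  have e3 : ‖(star A) (x - y)‖ ^ 2 < ε ^ 2 := by
    nlinarith [norm_nonneg (A (star A (x - y))), norm_nonneg (x - y)]
  simpa [dist_eq_norm] using lt_of_pow_lt_pow_left₀ 2 hε.le e3

/-- A compact operator has only finitely many eigenvalues of absolute value at least `r > 0` along
an orthonormal family of eigenvectors. -/
theorem IsCompactOperator.finite_setOf_le_norm_eigenvalue {ι : Type*} {b : ι → H}
    (hb : Orthonormal ℂ b) {B : H →L[ℂ] H} (hB : IsCompactOperator B) {μ : ι → ℂ}
    (hμ : ∀ a, B (b a) = μ a • b a) {r : ℝ} (hr : 0 < r) : {a | r ≤ ‖μ a‖}.Finite := by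
  have hK := (hB.isCompact_closure_image_closedBall 1).totallyBounded.subset subset_closure
  obtain ⟨t, htf, ht⟩ := Metric.totallyBounded_iff.1 hK (r / 2) (half_pos hr)
  by_contra hinf
  have hc : ∀ a, ∃ y ∈ t, B (b a) ∈ Metric.ball y (r / 2) := fun a => by
    simpa using ht ⟨b a, by simp [hb.1 a], rfl⟩
  choose y hyt hy using hc
  -- Pigeonhole: two distinct eigenvectors have images within `r` of each other, yet pairing the
  -- difference with `b a` returns `μ a`.
  obtain ⟨a, ha, a', ha', hne, he⟩ :=
    Set.Infinite.exists_ne_map_eq_of_mapsTo hinf (fun a _ => hyt a) htf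
  have h1 : dist (B (b a)) (B (b a')) < r := by
    have := dist_triangle_right (B (b a)) (B (b a')) (y a)
    have h3 := hy a
    have h4 := hy a'
    rw [← he] at h4
    rw [Metric.mem_ball] at h3 h4
    linarith
  have h2 : inner ℂ (b a) (B (b a) - B (b a')) = μ a := by
    rw [hμ, hμ, inner_sub_right, inner_smul_right, inner_smul_right, hb.inner_eq_zero hne,
      inner_self_eq_norm_sq_to_K, hb.1 a]
    simp
  have h3 := norm_inner_le_norm (𝕜 := ℂ) (b a) (B (b a) - B (b a'))
  rw [h2, hb.1 a, one_mul, ← dist_eq_norm] at h3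
  exact absurd (ha.trans h3) (not_le.2 h1)

theorem isCompactOperator_sum_smul {m : ℕ} {A : Fin m → H →L[ℂ] H}
    (hA : ∀ i, IsCompactOperator (A i)) (w : Fin m → ℂ) :
    IsCompactOperator (∑ i, w i • A i : H →L[ℂ] H) :=
  Submodule.sum_mem (compactOperator (RingHom.id ℂ) H H) (f := fun i => w i • A i)
    fun i _ => (hA i).smul (w i)

end Compact

/-! ### Simultaneous diagonalisation -/

section Spectral
variable {H : Type*} [NormedAddCommGroup H] [InnerProductSpace ℂ H] [CompleteSpace H]

/-- A compact symmetric operator has an eigenvector in each nonzero closed invariant subspace. -/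
theorem exists_inf_eigenspace_ne_bot {T : H →L[ℂ] H} (hT : IsCompactOperator T)
    (hs : T.IsSymmetric) {K : Submodule ℂ H} (hKc : IsClosed (K : Set H)) (hK : K ≠ ⊥)
    (hinv : ∀ v ∈ K, T v ∈ K) : ∃ c, K ⊓ End.eigenspace (T : H →ₗ[ℂ] H) c ≠ ⊥ := by
  have : CompleteSpace K := hKc.completeSpace_coe
  let S : K →L[ℂ] K := T.restrict hinv
  have hSc : IsCompactOperator S := hT.restrict' hinv
  have hSs : S.IsSymmetric := hs.restrict_invariant hinv
  by_contra! h
  have hb : ∀ c, End.eigenspace (S : K →ₗ[ℂ] K) c = ⊥ := by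
    intro c
    rw [eq_bot_iff]
    intro x hx
    have hx' : (x : H) ∈ K ⊓ End.eigenspace (T : H →ₗ[ℂ] H) c := by
      refine ⟨x.2, ?_⟩
      rw [End.mem_eigenspace_iff] at hx
      rw [SetLike.mem_coe, End.mem_eigenspace_iff]
      exact congrArg Subtype.val hx
    rw [h c, Submodule.mem_bot] at hx'
    simpa using hx'
  have := ContinuousLinearMap.orthogonalComplement_iSup_eigenspaces_eq_bot hSc hSs
  simp only [hb, iSup_bot, Submodule.bot_orthogonal_eq_top] at this
  have hn : Nontrivial K := Submodule.nontrivial_iff_ne_bot.2 hK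
  exact top_ne_bot this

/-- Commuting compact symmetric operators have a common eigenvector in each nonzero closed
invariant subspace. -/
theorem exists_common_eigenvector {ι : Type*} (s : Finset ι) {T : ι → H →L[ℂ] H}
    (hT : ∀ i, IsCompactOperator (T i)) (hs : ∀ i, (T i).IsSymmetric)
    (hcomm : ∀ i j, Commute (T i) (T j)) (K : Submodule ℂ H) (hKc : IsClosed (K : Set H))
    (hK : K ≠ ⊥) (hinv : ∀ i, ∀ v ∈ K, T i v ∈ K) :
    ∃ x ∈ K, x ≠ 0 ∧ ∀ i ∈ s, ∃ c : ℂ, T i x = c • x := by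
  classical
  induction s using Finset.induction_on generalizing K with
  | empty =>
    obtain ⟨x, hx, hx0⟩ := Submodule.exists_mem_ne_zero_of_ne_bot hK
    exact ⟨x, hx, hx0, by simp⟩
  | insert j s hj ih =>
    obtain ⟨c, hc⟩ := exists_inf_eigenspace_ne_bot (hT j) (hs j) hKc hK (hinv j)
    have hcl : IsClosed ((K ⊓ End.eigenspace (T j : H →ₗ[ℂ] H) c : Submodule ℂ H) : Set H) := by
      rw [Submodule.coe_inf]
      refine hKc.inter ?_
      have : (End.eigenspace (T j : H →ₗ[ℂ] H) c : Set H) = {x | T j x = c • x} := by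
        ext x
        simp
      rw [this]
      exact isClosed_eq (T j).continuous (continuous_const_smul c)
    obtain ⟨x, hx, hx0, hxs⟩ := ih _ hcl hc (fun i v hv => by
      refine ⟨hinv i v hv.1, ?_⟩
      have h1 := End.mem_eigenspace_iff.1 hv.2
      rw [SetLike.mem_coe, End.mem_eigenspace_iff]
      have h2 : T j (T i v) = T i (T j v) := DFunLike.congr_fun (hcomm j i).eq v
      simp only [ContinuousLinearMap.coe_coe] at h1 ⊢
      rw [h2, h1, map_smul])
    refine ⟨x, hx.1, hx0, fun i hi => ?_⟩
    rcases Finset.mem_insert.1 hi with rfl | hi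
    · exact ⟨c, End.mem_eigenspace_iff.1 hx.2⟩
    · exact hxs i hi

/-- The spectral theorem for a finite family of commuting compact symmetric operators. -/
theorem exists_hilbertBasis_common_eigenvectors {ι : Type*} [Finite ι] {T : ι → H →L[ℂ] H}
    (hT : ∀ i, IsCompactOperator (T i)) (hs : ∀ i, (T i).IsSymmetric)
    (hcomm : ∀ i j, Commute (T i) (T j)) :
    ∃ (w : Set H) (b : HilbertBasis w ℂ H), ∀ i a, ∃ c : ℂ, T i (b a) = c • b a := by
  have := Fintype.ofFinite ι
  -- Take a maximal orthonormal set of common eigenvectors. By symmetry its orthogonal complement is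
  -- invariant, so a nonzero complement would supply one more.
  obtain ⟨w, -, hw⟩ := zorn_subset_nonempty
    {s : Set H | Orthonormal ℂ (Subtype.val : s → H) ∧ ∀ x ∈ s, ∀ i, ∃ c : ℂ, T i x = c • x}
    (fun c hc cc _ => ⟨⋃₀ c, ⟨orthonormal_sUnion_of_directed cc.directedOn fun x xc => (hc xc).1,
      fun x ⟨s, hsc, hxs⟩ => (hc hsc).2 x hxs⟩, fun _ => Set.subset_sUnion_of_mem⟩) ∅
    ⟨⟨fun a => a.2.elim, fun a => a.2.elim⟩, fun x hx => hx.elim⟩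
  have hbot : (Submodule.span ℂ (Set.range (Subtype.val : w → H)))ᗮ = ⊥ := by
    by_contra hne
    rw [Subtype.range_coe] at hne
    obtain ⟨x, hx, hx0, hxT⟩ := exists_common_eigenvector Finset.univ hT hs hcomm
      (Submodule.span ℂ w)ᗮ (Submodule.isClosed_orthogonal _) hne (fun i v hv => by
        rw [Submodule.mem_orthogonal] at hv ⊢
        intro u hu
        induction hu using Submodule.span_induction with
        | mem u hu =>
          obtain ⟨c, hc⟩ := hw.1.2 u hu i
          have h1 := hs i u v
          simp only [ContinuousLinearMap.coe_coe] at h1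
          rw [← h1, hc, inner_smul_left, hv u (Submodule.subset_span hu), mul_zero]
        | zero => simp
        | add u u' _ _ h h' => rw [inner_add_left, h, h', add_zero]
        | smul c u _ h => rw [inner_smul_left, h, mul_zero])
    have hxw : ∀ u ∈ w, inner ℂ u x = 0 := fun u hu =>
      Submodule.mem_orthogonal _ _ |>.1 hx u (Submodule.subset_span hu)
    set e : H := ((‖x‖ : ℂ)⁻¹) • x with he
    have hxn : (‖x‖ : ℂ) ≠ 0 := by simpa using hx0
    have hew : ∀ u ∈ w, inner ℂ u e = 0 := fun u hu => by
      rw [he, inner_smul_right, hxw u hu, mul_zero]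
    have hen : ‖e‖ = 1 := by
      rw [he, norm_smul]
      simp [norm_ne_zero_iff.2 hx0]
    have hmem : insert e w ∈ {s : Set H | Orthonormal ℂ (Subtype.val : s → H) ∧
        ∀ x ∈ s, ∀ i, ∃ c : ℂ, T i x = c • x} := by
      refine ⟨⟨?_, ?_⟩, ?_⟩
      · rintro ⟨u, rfl | hu⟩
        · exact hen
        · exact hw.1.1.1 ⟨u, hu⟩
      · rintro ⟨u, hu⟩ ⟨v, hv⟩ huv
        rcases hu with rfl | hu <;> rcases hv with rfl | hv
        · exact absurd rfl huv
        · exact inner_eq_zero_symm.1 (hew v hv)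
        · exact hew u hu
        · exact hw.1.1.2 (i := ⟨u, hu⟩) (j := ⟨v, hv⟩) 
            (fun h => huv (Subtype.ext (Subtype.mk_eq_mk.1 h)))
      · rintro u (rfl | hu) i
        · obtain ⟨c, hc⟩ := hxT i (Finset.mem_univ i)
          exact ⟨c, by rw [he, map_smul, hc, smul_comm]⟩
        · exact hw.1.2 u hu i
    have : e ∈ w := hw.2 hmem (Set.subset_insert _ _) (Set.mem_insert _ _)
    have h0 := hew e this
    rw [inner_self_eq_zero] at h0
    simp [h0] at hen
  refine ⟨w, HilbertBasis.mkOfOrthogonalEqBot hw.1.1 hbot, fun i a => ?_⟩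
  rw [HilbertBasis.coe_mkOfOrthogonalEqBot]
  exact hw.1.2 a a.2 i

theorem isSymmetric_add_star (A : H →L[ℂ] H) : (A + star A).IsSymmetric :=
  (IsSelfAdjoint.add_star_self A).isSymmetric

/-- The spectral theorem for commuting compact normal operators. -/
theorem IsCommutingNormalFamily.exists_hilbertBasis {m : ℕ} {A : Fin m → H →L[ℂ] H}
    (h : IsCommutingNormalFamily A) (hA : ∀ i, IsCompactOperator (A i)) :
    ∃ (w : Set H) (b : HilbertBasis w ℂ H) (μ : w → Fin m → ℂ),
      ∀ a i, A i (b a) = μ a i • b a := by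
  -- Fuglede's theorem.
  have hc1 : ∀ i j, Commute (A i) (star (A j)) := fun i j => (h.1 j).commute_star_right (h.2 i j)
  have hc2 : ∀ i j, Commute (star (A i)) (star (A j)) := fun i j => (h.2 i j).star_star
  -- Up to scalars, these are the real and imaginary parts: `A + A*` and `i(A - A*)`.
  let T : Fin m × Bool → H →L[ℂ] H := fun p =>
    (if p.2 then 1 else Complex.I) • A p.1 + star ((if p.2 then 1 else Complex.I) • A p.1)
  have hTe : ∀ p, ∃ c d : ℂ, T p = c • A p.1 + d • star (A p.1) := fun p =>
    ⟨_, _, by simp only [T, star_smul]; rfl⟩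
  obtain ⟨w, b, hb⟩ := exists_hilbertBasis_common_eigenvectors (T := T)
    (fun p => by
      obtain ⟨c, d, e⟩ := hTe p
      rw [e]
      exact ((hA p.1).smul c).add ((hA p.1).star_clm.smul d))
    (fun p => isSymmetric_add_star _)
    (fun p q => by
      obtain ⟨c, d, e⟩ := hTe p
      obtain ⟨c', d', e'⟩ := hTe q
      rw [e, e']
      exact (((h.2 _ _).smul_left _).smul_right _).add_right (((hc1 _ _).smul_left _).smul_right _)
        |>.add_left ((((hc1 _ _).symm.smul_left _).smul_right _).add_right
          (((hc2 _ _).smul_left _).smul_right _)))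
  have : ∀ a i, ∃ c : ℂ, A i (b a) = c • b a := by
    intro a i
    obtain ⟨c, hc⟩ := hb (i, true) a
    obtain ⟨d, hd⟩ := hb (i, false) a
    refine ⟨(c - Complex.I * d) / 2, ?_⟩
    have e : A i = (1 / 2 : ℂ) • (T (i, true) - Complex.I • T (i, false)) := by
      have h1 : T (i, true) = A i + star (A i) := by simp [T]
      have h2 : Complex.I • T (i, false) = -A i + star (A i) := by
        simp [T, smul_add, smul_smul, star_smul]
      rw [h1, h2, show A i + star (A i) - (-A i + star (A i)) = (2 : ℂ) • A i by
        rw [two_smul]; abel, smul_smul]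
      norm_num
    rw [e, _root_.smul_apply, _root_.sub_apply,
      _root_.smul_apply, hc, hd, smul_smul, ← sub_smul, smul_smul]
    congr 1
    ring
  choose μ hμ using this
  exact ⟨w, b, μ, hμ⟩

end Spectral

/-! ### Diagonals of finite-rank projections -/

section Weights
variable {H : Type*} [NormedAddCommGroup H] [InnerProductSpace ℂ H] {ι : Type*}

theorem HilbertBasis.hasSum_norm_inner_sq (b : HilbertBasis ι ℂ H) (x : H) :
    HasSum (fun a => ‖inner ℂ (b a) x‖ ^ 2) (‖x‖ ^ 2) := by
  have h := b.hasSum_inner_mul_inner x x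
  rw [inner_self_eq_norm_sq_to_K] at h
  have h2 := Complex.hasSum_re h
  have h3 : (((‖x‖ : ℝ) : ℂ) ^ 2).re = ‖x‖ ^ 2 := by norm_cast
  have h4 : ∀ a, (inner ℂ x (b a) * inner ℂ (b a) x : ℂ).re = ‖inner ℂ (b a) x‖ ^ 2 := fun a => by
    rw [← inner_conj_symm x, Complex.conj_mul']
    norm_cast
  simp only [h4] at h2
  exact h3 ▸ h2

theorem HilbertBasis.hasSum_inner_apply (b : HilbertBasis ι ℂ H) {T : H →L[ℂ] H} {μ : ι → ℂ}
    (hμ : ∀ a, T (b a) = μ a • b a) (x : H) :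
    HasSum (fun a => (‖inner ℂ (b a) x‖ ^ 2 : ℝ) * μ a) (inner ℂ x (T x)) := by
  have h := ((b.hasSum_repr x).mapL T).mapL (innerSL ℂ x)
  have e : ∀ a, innerSL ℂ x (T (b.repr x a • b a)) = (‖inner ℂ (b a) x‖ ^ 2 : ℝ) * μ a := by
    intro a
    have : ((‖inner ℂ (b a) x‖ ^ 2 : ℝ) : ℂ) =
        inner ℂ (b a) x * (starRingEnd ℂ) (inner ℂ (b a) x) := by
      rw [Complex.mul_conj']
      norm_cast
    rw [map_smul, hμ, innerSL_apply_apply, inner_smul_right, inner_smul_right,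
      b.repr_apply_apply, ← inner_conj_symm x (b a), this]
    ring
  simp only [e] at h
  exact h

/-- The diagonal, with respect to `b`, of the projection onto the span of the orthonormal
vectors `x`. -/
noncomputable def projectionDiagonal {κ : Type*} [Fintype κ] (b : ι → H) (x : κ → H) (a : ι) : ℝ :=
  ∑ l, ‖inner ℂ (b a) (x l)‖ ^ 2

variable {k : ℕ} {x : Fin k → H}

theorem projectionDiagonal_nonneg (b : ι → H) (x : Fin k → H) (a : ι) :
    0 ≤ projectionDiagonal b x a :=
  Finset.sum_nonneg fun _ _ => by positivity

theorem projectionDiagonal_le_one (b : HilbertBasis ι ℂ H) (hx : Orthonormal ℂ x) (a : ι) :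
    projectionDiagonal b x a ≤ 1 := by
  have := hx.sum_inner_products_le (b a) (s := Finset.univ)
  rw [b.orthonormal.1 a, one_pow] at this
  refine le_trans (le_of_eq (Finset.sum_congr rfl fun l _ => ?_)) this
  rw [norm_inner_symm]

theorem hasSum_projectionDiagonal (b : HilbertBasis ι ℂ H) (hx : Orthonormal ℂ x) :
    HasSum (projectionDiagonal b x) k := by
  have h := hasSum_sum (s := Finset.univ) fun l (_ : l ∈ Finset.univ) =>
    b.hasSum_norm_inner_sq (x l)
  simp only [hx.1, one_pow, Finset.sum_const, Finset.card_univ, Fintype.card_fin, nsmul_eq_mul,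
    mul_one] at h
  exact h

theorem hasSum_projectionDiagonal_mul (b : HilbertBasis ι ℂ H) {T : H →L[ℂ] H} {μ : ι → ℂ}
    (hμ : ∀ a, T (b a) = μ a • b a) (x : Fin k → H) :
    HasSum (fun a => (projectionDiagonal b x a : ℂ) * μ a) (∑ l, inner ℂ (x l) (T (x l))) := by
  have h := hasSum_sum (s := Finset.univ) fun l (_ : l ∈ Finset.univ) =>
    b.hasSum_inner_apply hμ (x l)
  convert h using 2 with a
  rw [projectionDiagonal, Complex.ofReal_sum, Finset.sum_mul]

end Weights

/-! ### Common eigenvectors and Gram–Schmidt -/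

section Triangular
variable {H : Type*} [NormedAddCommGroup H] [InnerProductSpace ℂ H]

/-- Gram–Schmidt applied to eigenvectors puts an operator in triangular form. -/
theorem exists_orthonormal_of_common_eigenvectors {k m : ℕ} {A : Fin m → H →L[ℂ] H}
    {μ : Fin k → Fin m → ℂ} {y : Fin k → H} (hy : LinearIndependent ℂ y)
    (hμ : ∀ l i, A i (y l) = μ l i • y l) :
    ∃ z : Fin k → H, Orthonormal ℂ z ∧
      Submodule.span ℂ (Set.range z) = Submodule.span ℂ (Set.range y) ∧
      ∀ l i, inner ℂ (z l) (A i (z l)) = μ l i := by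
  let z := InnerProductSpace.gramSchmidtNormed ℂ y
  have hz : Orthonormal ℂ z := InnerProductSpace.gramSchmidtNormed_orthonormal hy
  have hspan : ∀ s : Set (Fin k), Submodule.span ℂ (z '' s) =
      Submodule.span ℂ (InnerProductSpace.gramSchmidt ℂ y '' s) := fun s =>
    InnerProductSpace.span_gramSchmidtNormed y s
  refine ⟨z, hz, ?_, fun l i => ?_⟩
  · rw [InnerProductSpace.span_gramSchmidtNormed_range, InnerProductSpace.span_gramSchmidt]
  · have hlt : Submodule.span ℂ (z '' Set.Iio l) = Submodule.span ℂ (y '' Set.Iio l) := by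
      rw [hspan, InnerProductSpace.span_gramSchmidt_Iio]
    have hle : Submodule.span ℂ (z '' Set.Iic l) = Submodule.span ℂ (y '' Set.Iic l) := by
      rw [hspan, InnerProductSpace.span_gramSchmidt_Iic]
    -- `A i - μ l i` kills `y l` and preserves the span of the earlier vectors, to which `z l` is
    -- orthogonal.
    have hmem : ∀ v ∈ Submodule.span ℂ (y '' Set.Iic l),
        A i v - μ l i • v ∈ Submodule.span ℂ (y '' Set.Iio l) := by
      intro v hv
      induction hv using Submodule.span_induction with
      | mem v hv =>
        obtain ⟨j, hj, rfl⟩ := hv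
        rw [hμ, ← sub_smul]
        rcases (Set.mem_Iic.1 hj).lt_or_eq with h | rfl
        · exact Submodule.smul_mem _ _ (Submodule.subset_span ⟨j, h, rfl⟩)
        · simp
      | zero => simp
      | add u v _ _ hu hv =>
        have : A i (u + v) - μ l i • (u + v) = (A i u - μ l i • u) + (A i v - μ l i • v) := by
          rw [map_add, smul_add]; abel
        rw [this]
        exact add_mem hu hv
      | smul c v _ hv =>
        have : A i (c • v) - μ l i • (c • v) = c • (A i v - μ l i • v) := by
          rw [map_smul, smul_sub, smul_comm]
        rw [this]
        exact Submodule.smul_mem _ _ hv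
    have hzl : z l ∈ Submodule.span ℂ (y '' Set.Iic l) := by
      rw [← hle]
      exact Submodule.subset_span ⟨l, Set.mem_Iic.2 le_rfl, rfl⟩
    have h0 : ∀ v ∈ Submodule.span ℂ (z '' Set.Iio l), inner ℂ (z l) v = 0 := by
      intro v hv
      induction hv using Submodule.span_induction with
      | mem v hv =>
        obtain ⟨j, hj, rfl⟩ := hv
        exact hz.2 (ne_of_gt hj)
      | zero => simp
      | add u v _ _ hu hv => rw [inner_add_right, hu, hv, add_zero]
      | smul c v _ hv => rw [inner_smul_right, hv, mul_zero]
    have h1 := h0 _ (hlt ▸ hmem _ hzl)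
    rw [inner_sub_right, inner_smul_right, inner_self_eq_norm_sq_to_K, hz.1 l, sub_eq_zero] at h1
    simpa using h1

theorem jointEigenvalueSums_subset_jointNumericalRange {m : ℕ} (k : ℕ) (A : Fin m → H →L[ℂ] H) :
    jointEigenvalueSums k A ⊆ jointNumericalRange k A := by
  rintro _ ⟨μ, y, hy, hμ, rfl⟩
  obtain ⟨z, hz, -, h⟩ := exists_orthonormal_of_common_eigenvectors hy fun l => (hμ l).2
  exact ⟨z, hz, fun i => by simp [h]⟩

end Triangular

/-! ### Hypersimplices -/

section Hypersimplex
variable {ι : Type*}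

/-- Move the weight `δ` from the coordinate `j` to the coordinate `i`. -/
noncomputable def shiftWeight (t : ι → ℝ) (i j : ι) (δ : ℝ) (a : ι) : ℝ :=
  open Classical in if a = i then t i + δ else if a = j then t j - δ else t a

theorem shiftWeight_left (t : ι → ℝ) (i j : ι) (δ : ℝ) : shiftWeight t i j δ i = t i + δ := by
  simp [shiftWeight]

theorem shiftWeight_right (t : ι → ℝ) {i j : ι} (hij : i ≠ j) (δ : ℝ) :
    shiftWeight t i j δ j = t j - δ := by
  simp [shiftWeight, hij.symm]

theorem shiftWeight_of_ne (t : ι → ℝ) {i j a : ι} (hi : a ≠ i) (hj : a ≠ j) (δ : ℝ) :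
    shiftWeight t i j δ a = t a := by
  simp [shiftWeight, hi, hj]

theorem sum_shiftWeight_smul {E : Type*} [AddCommGroup E] [Module ℝ E] (μ : ι → E) (t : ι → ℝ)
    {s : Finset ι} {i j : ι} (hi : i ∈ s) (hj : j ∈ s) (hij : i ≠ j) (δ : ℝ) :
    ∑ a ∈ s, shiftWeight t i j δ a • μ a = ∑ a ∈ s, t a • μ a + δ • (μ i - μ j) := by
  classical
  have hj' : j ∈ s.erase i := Finset.mem_erase.2 ⟨hij.symm, hj⟩
  rw [← Finset.add_sum_erase s _ hi, ← Finset.add_sum_erase _ _ hj',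
    ← Finset.add_sum_erase s (fun a => t a • μ a) hi,
    ← Finset.add_sum_erase _ (fun a => t a • μ a) hj',
    shiftWeight_left, shiftWeight_right t hij,
    Finset.sum_congr rfl fun a ha => by
      rw [shiftWeight_of_ne t (Finset.ne_of_mem_erase (Finset.mem_of_mem_erase ha))
        (Finset.ne_of_mem_erase ha) δ]]
  module

theorem shiftWeight_mem_Icc {t : ι → ℝ} (h : ∀ a, t a ∈ Set.Icc 0 1) {i j : ι} (hij : i ≠ j)
    {δ : ℝ} (hi : t i + δ ∈ Set.Icc 0 1) (hj : t j - δ ∈ Set.Icc 0 1) (a : ι) :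
    shiftWeight t i j δ a ∈ Set.Icc 0 1 := by
  rcases eq_or_ne a i with rfl | hai
  · rwa [shiftWeight_left]
  rcases eq_or_ne a j with rfl | haj
  · rwa [shiftWeight_right t hij]
  · rw [shiftWeight_of_ne t hai haj]
    exact h a

-- This count of fractional coordinates is the measure that decreases in `hypersimplex_induction`.
open Classical in
theorem card_filter_shiftWeight_lt {t : ι → ℝ} {s : Finset ι} {i j : ι} (hi : i ∈ s) (hj : j ∈ s)
    (hij : i ≠ j) (hti : t i ∈ Set.Ioo 0 1) (htj : t j ∈ Set.Ioo 0 1) {δ : ℝ}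
    (h : t i + δ ∉ Set.Ioo 0 1 ∨ t j - δ ∉ Set.Ioo 0 1) :
    (s.filter fun a => shiftWeight t i j δ a ∈ Set.Ioo 0 1).card <
      (s.filter fun a => t a ∈ Set.Ioo 0 1).card := by
  refine Finset.card_lt_card ((Finset.ssubset_iff_of_subset ?_).2 ?_)
  · intro a ha
    rw [Finset.mem_filter] at ha ⊢
    refine ⟨ha.1, ?_⟩
    rcases eq_or_ne a i with rfl | hai
    · exact hti
    rcases eq_or_ne a j with rfl | haj
    · exact htj
    · have := ha.2
      rwa [shiftWeight_of_ne t hai haj] at this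
  · rcases h with h | h
    · exact ⟨i, Finset.mem_filter.2 ⟨hi, hti⟩, fun h' => h (by
        simpa only [shiftWeight_left] using (Finset.mem_filter.1 h').2)⟩
    · exact ⟨j, Finset.mem_filter.2 ⟨hj, htj⟩, fun h' => h (by
        simpa only [shiftWeight_right t hij] using (Finset.mem_filter.1 h').2)⟩

open Classical in
/-- An induction principle for the points of a hypersimplex: a property holds for all weights in
`[0, 1]` of integral total mass `k` if it holds for the indicators of `k`-element sets and passes
from two points to every point between them on a line in a direction `e_i - e_j`. -/
theorem hypersimplex_induction {s : Finset ι} {k : ℕ} {Q : (ι → ℝ) → Prop}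
    (ind : ∀ u ⊆ s, u.card = k → Q fun a => if a ∈ u then 1 else 0)
    (step : ∀ t, ∀ i ∈ s, ∀ j ∈ s, i ≠ j → ∀ α β, 0 < α → 0 < β → Q (shiftWeight t i j (-α)) →
      Q (shiftWeight t i j β) → Q t)
    (t : ι → ℝ) (h01 : ∀ a, t a ∈ Set.Icc 0 1) (hs : ∀ a ∉ s, t a = 0)
    (hk : ∑ a ∈ s, t a = k) : Q t := by
  induction hn : (s.filter fun a => t a ∈ Set.Ioo 0 1).card using Nat.strong_induction_on
    generalizing t with
  | _ n ih =>
  have hfrac : ∀ a, t a ∉ Set.Ioo 0 1 → t a = if t a = 1 then 1 else 0 := by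
    intro a ha
    split_ifs with h
    · exact h
    · have := h01 a
      by_contra h0
      exact ha ⟨lt_of_le_of_ne this.1 (Ne.symm h0), lt_of_le_of_ne this.2 h⟩
  rcases (s.filter fun a => t a ∈ Set.Ioo 0 1).eq_empty_or_nonempty with hF | ⟨i, hi⟩
  · have hF' : ∀ a, t a = if a ∈ s.filter (fun a => t a = 1) then 1 else 0 := by
      intro a
      by_cases ha : a ∈ s
      · rw [hfrac a fun h => Finset.notMem_empty a (hF ▸ Finset.mem_filter.2 ⟨ha, h⟩)]
        simp [ha]
      · simp [ha, hs a ha]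
    rw [show t = fun a => if a ∈ s.filter (fun a => t a = 1) then 1 else 0 from funext hF']
    refine ind _ (Finset.filter_subset _ _) ?_
    have := hk
    rw [Finset.sum_congr rfl fun a _ => hF' a, Finset.sum_ite_mem,
      Finset.inter_eq_right.2 (Finset.filter_subset _ _)] at this
    simpa using this
  · rw [Finset.mem_filter] at hi
    obtain ⟨his, hti⟩ := hi
    -- A single fractional coordinate cannot occur when the total mass is an integer.
    obtain ⟨j, hjs, hji, htj⟩ : ∃ j ∈ s, j ≠ i ∧ t j ∈ Set.Ioo 0 1 := by
      by_contra! hne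
      rw [← Finset.add_sum_erase s _ his, Finset.sum_congr rfl fun a ha =>
        hfrac a (hne a (Finset.mem_of_mem_erase ha) (Finset.ne_of_mem_erase ha)),
        ← Finset.sum_filter, Finset.sum_const, nsmul_eq_mul, mul_one] at hk
      have h0 := hti.1
      have h1 := hti.2
      rw [← sub_eq_iff_eq_add.2 hk.symm] at h0 h1
      have h0' := sub_pos.1 h0
      have h1' : (k : ℝ) < 1 + (((s.erase i).filter fun a => t a = 1).card : ℝ) := by linarith
      norm_cast at h0' h1'
      omega
    have hij := hji.symm
    have hti0 := hti.1
    have hti1 := hti.2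
    have htj0 := htj.1
    have htj1 := htj.2
    have key : ∀ δ, t i + δ ∈ Set.Icc 0 1 → t j - δ ∈ Set.Icc 0 1 →
        (t i + δ ∉ Set.Ioo 0 1 ∨ t j - δ ∉ Set.Ioo 0 1) → Q (shiftWeight t i j δ) := by
      intro δ h1 h2 h3
      refine ih _ ?_ _ (shiftWeight_mem_Icc h01 hij h1 h2) ?_ ?_ rfl
      · rw [← hn]
        exact card_filter_shiftWeight_lt his hjs hij hti htj h3
      · intro a ha
        rw [shiftWeight_of_ne t (by rintro rfl; exact ha his) (by rintro rfl; exact ha hjs), hs a ha]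
      · have := sum_shiftWeight_smul (fun _ => (1 : ℝ)) t his hjs hij δ
        simpa [hk] using this
    -- These are the largest shifts that keep both coordinates in `[0, 1]`; each brings at least one
    -- of them to an endpoint.
    refine step t i his j hjs hij (min (t i) (1 - t j)) (min (1 - t i) (t j))
      (lt_min hti0 (by linarith)) (lt_min (by linarith) htj0) (key _ ?_ ?_ ?_) (key _ ?_ ?_ ?_)
    · constructor
      · linarith [min_le_left (t i) (1 - t j)]
      · linarith [lt_min hti0 (sub_pos.2 htj1)]
    · constructor
      · linarith [lt_min hti0 (sub_pos.2 htj1)]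
      · linarith [min_le_right (t i) (1 - t j)]
    · rcases min_choice (t i) (1 - t j) with h | h <;> rw [h]
      · exact Or.inl fun h => by linarith [h.1]
      · exact Or.inr fun h => by linarith [h.2]
    · constructor
      · linarith [lt_min (sub_pos.2 hti1) htj0]
      · linarith [min_le_left (1 - t i) (t j)]
    · constructor
      · linarith [min_le_right (1 - t i) (t j)]
      · linarith [lt_min (sub_pos.2 hti1) htj0]
    · rcases min_choice (1 - t i) (t j) with h | h <;> rw [h]
      · exact Or.inl fun h => by linarith [h.2]
      · exact Or.inr fun h => by linarith [h.1]

/-- Weighted sums over a hypersimplex are convex combinations of sums over `k`-element sets. -/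
theorem sum_smul_mem_convexHull_of_hypersimplex {E : Type*} [AddCommGroup E] [Module ℝ E]
    (μ : ι → E) {s : Finset ι} {k : ℕ} {t : ι → ℝ} (h01 : ∀ a, t a ∈ Set.Icc 0 1)
    (hs : ∀ a ∉ s, t a = 0) (hk : ∑ a ∈ s, t a = k) :
    ∑ a ∈ s, t a • μ a ∈ convexHull ℝ {p | ∃ u : Finset ι, u.card = k ∧ p = ∑ a ∈ u, μ a} := by
  classical
  refine hypersimplex_induction (Q := fun t => ∑ a ∈ s, t a • μ a ∈ convexHull ℝ
    {p | ∃ u : Finset ι, u.card = k ∧ p = ∑ a ∈ u, μ a}) ?_ ?_ t h01 hs hk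
  · intro u hu huk
    refine subset_convexHull ℝ _ ⟨u, huk, ?_⟩
    simp only [ite_smul, one_smul, zero_smul]
    rw [Finset.sum_ite_mem, Finset.inter_eq_right.2 hu]
  · intro t i hi j hj hij α β hα hβ h1 h2
    rw [sum_shiftWeight_smul μ t hi hj hij] at h1 h2
    have := (convex_convexHull ℝ _) h1 h2 (a := β / (α + β)) (b := α / (α + β)) (by positivity)
      (by positivity) (by field_simp; ring)
    convert this using 1
    match_scalars <;> field_simp <;> ring

end Hypersimplex

/-! ### Reduction to finitely supported weights -/

section FiniteSupport
variable {ι : Type*}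

/-- A convergent series in a finite-dimensional space with weights in `[0, 1]`, finitely many of
them equal to `1`, has the same sum as a finite one. -/
theorem exists_finset_sum_smul_eq_of_hasSum {F : Type*} [NormedAddCommGroup F] [NormedSpace ℝ F]
    [FiniteDimensional ℝ F] {ν : ι → F} {t : ι → ℝ} {q : F} (h01 : ∀ a, t a ∈ Set.Icc 0 1)
    (h1 : {a | t a = 1}.Finite) (hq : HasSum (fun a => t a • ν a) q) :
    ∃ (s : Finset ι) (t' : ι → ℝ), (∀ a, t' a ∈ Set.Icc 0 1) ∧ (∀ a ∉ s, t' a = 0) ∧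
      ∑ a ∈ s, t' a • ν a = q := by
  classical
  let J : Set ι := {a | t a ∈ Set.Ioo 0 1}
  obtain ⟨c, hcJ, hspan, hli⟩ := exists_linearIndependent ℝ (ν '' J)
  have hcf : c.Finite := hli.setFinite
  -- Finitely many fractional indices `B` carry vectors spanning all of `ν '' J`. Their weights have
  -- room on both sides, so they can absorb a small tail of the series through the continuous linear
  -- section `G`.
  obtain ⟨B', hB'J, hB'f, hB'⟩ := Set.exists_subset_image_finite_and
    (p := fun c => Submodule.span ℝ c = Submodule.span ℝ (ν '' J)).1 ⟨c, hcJ, hcf, hspan⟩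
  obtain ⟨B, rfl⟩ := hB'f.exists_finset_coe
  let Φ : (B → ℝ) →ₗ[ℝ] F := Fintype.linearCombination ℝ fun b : B => ν b
  have hrange : LinearMap.range Φ = Submodule.span ℝ (ν '' J) := by
    rw [← hB', Fintype.range_linearCombination]
    congr 1
    ext v
    simp
  obtain ⟨R, hR⟩ := LinearMap.exists_rightInverse_of_surjective Φ.rangeRestrict
    Φ.range_rangeRestrict
  obtain ⟨G, hG⟩ := LinearMap.exists_extend R
  have hΦG : ∀ v ∈ Submodule.span ℝ (ν '' J), Φ (G v) = v := by
    intro v hv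
    rw [← hrange] at hv
    have e1 : G v = R ⟨v, hv⟩ := LinearMap.congr_fun hG ⟨v, hv⟩
    have e2 := congrArg Subtype.val (LinearMap.congr_fun hR ⟨v, hv⟩)
    rw [e1]
    exact e2
  have hGc : Continuous G := G.continuous_of_finiteDimensional
  have hr0 : Tendsto (fun S : Finset ι => q - ∑ a ∈ S, t a • ν a) atTop (𝓝 0) := by
    simpa using (tendsto_const_nhds (x := q)).sub hq
  have hsmall : ∀ b : B, ∀ᶠ S : Finset ι in atTop,
      t b + G (q - ∑ a ∈ S, t a • ν a) b ∈ Set.Ioo 0 1 := by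
    intro b
    have h2 : Tendsto (fun S : Finset ι => t b + G (q - ∑ a ∈ S, t a • ν a) b) atTop
        (𝓝 (t b)) := by
      have := (((continuous_apply b).comp hGc).tendsto 0).comp hr0
      simpa using this.const_add (t b)
    exact h2.eventually (isOpen_Ioo.mem_nhds (hB'J b.2))
  -- Including every index of weight `1` in `S` leaves only weights that are zero or fractional
  -- outside it, so the tail `r` lies in the closed span of `ν '' J`.
  obtain ⟨S, hS, hSsub⟩ := ((eventually_all.2 hsmall).and
    (eventually_ge_atTop (B ∪ h1.toFinset))).exists
  have hBS : B ⊆ S := Finset.union_subset_left hSsub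
  have h1S : ∀ a, t a = 1 → a ∈ S := fun a ha =>
    Finset.union_subset_right hSsub (h1.mem_toFinset.2 ha)
  set r := q - ∑ a ∈ S, t a • ν a with hr
  have hrV : r ∈ Submodule.span ℝ (ν '' J) := by
    have hcl : IsClosed (Submodule.span ℝ (ν '' J) : Set F) :=
      Submodule.closed_of_finiteDimensional _
    refine hcl.mem_of_tendsto (hq.sub_const (∑ a ∈ S, t a • ν a)) ?_
    filter_upwards [eventually_ge_atTop S] with S' hS'
    rw [← Finset.sum_sdiff hS', add_sub_cancel_right]
    refine Submodule.sum_mem _ fun a ha => ?_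
    have haS := (Finset.mem_sdiff.1 ha).2
    rcases eq_or_ne (t a) 0 with h | h
    · rw [h, zero_smul]
      exact Submodule.zero_mem _
    · exact Submodule.smul_mem _ _ (Submodule.subset_span ⟨a, ⟨lt_of_le_of_ne (h01 a).1 h.symm,
        lt_of_le_of_ne (h01 a).2 fun h => haS (h1S a h)⟩, rfl⟩)
  refine ⟨S, fun a => if a ∈ S then t a + (if h : a ∈ B then G r ⟨a, h⟩ else 0) else 0,
    fun a => ?_, fun a ha => if_neg ha, ?_⟩
  · dsimp only
    split_ifs with h h'
    · exact Set.Ioo_subset_Icc_self (hS ⟨a, h'⟩)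
    · simpa using h01 a
    · simp
  · have e1 : ∑ a ∈ S, (if h : a ∈ B then G r ⟨a, h⟩ else 0) • ν a = r := by
      rw [← Finset.sum_subset hBS fun a _ ha => by rw [dif_neg ha, zero_smul],
        ← Finset.sum_coe_sort B]
      refine Eq.trans ?_ (hΦG r hrV)
      rw [Fintype.linearCombination_apply]
      exact Finset.sum_congr rfl fun b _ => by rw [dif_pos b.2]
    have e2 : ∀ a ∈ S, (if a ∈ S then t a + (if h : a ∈ B then G r ⟨a, h⟩ else 0) else 0) • ν a =
        t a • ν a + (if h : a ∈ B then G r ⟨a, h⟩ else 0) • ν a := fun a ha => by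
      rw [if_pos ha, add_smul]
    rw [Finset.sum_congr rfl e2, Finset.sum_add_distrib, e1, add_comm, hr, sub_add_cancel]

theorem exists_finset_sum_eq_and_sum_smul_eq {E : Type*} [NormedAddCommGroup E] [NormedSpace ℝ E]
    [FiniteDimensional ℝ E] {μ : ι → E} {t : ι → ℝ} {p : E} {c : ℝ}
    (h01 : ∀ a, t a ∈ Set.Icc 0 1) (hc : HasSum t c) (hp : HasSum (fun a => t a • μ a) p) :
    ∃ (s : Finset ι) (t' : ι → ℝ), (∀ a, t' a ∈ Set.Icc 0 1) ∧ (∀ a ∉ s, t' a = 0) ∧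
      ∑ a ∈ s, t' a = c ∧ ∑ a ∈ s, t' a • μ a = p := by
  have h1 : {a | t a = 1}.Finite := by
    have := hc.summable.tendsto_cofinite_zero.eventually (gt_mem_nhds zero_lt_one)
    refine this.subset fun a ha => ?_
    simp_all
  -- The extra coordinate `1` preserves the total mass together with the vector sum.
  obtain ⟨s, t', ht', hs, he⟩ := exists_finset_sum_smul_eq_of_hasSum (ν := fun a => (μ a, (1 : ℝ)))
    (q := (p, c)) h01 h1 (by simpa using hp.prodMk hc)
  refine ⟨s, t', ht', hs, ?_, ?_⟩
  · simpa [Prod.snd_sum] using congrArg Prod.snd he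
  · simpa [Prod.fst_sum] using congrArg Prod.fst he

end FiniteSupport

/-! ### Realising prescribed diagonals -/

section SchurHorn
variable {H : Type*} [NormedAddCommGroup H] [InnerProductSpace ℂ H] {ι : Type*} {k : ℕ}

/-- Rotating orthonormal vectors in the plane of `b i` and `b j` moves two entries of the
diagonal of the projection to any values between them with the same sum. -/
theorem exists_orthonormal_projectionDiagonal_rotate {b : ι → H} (hb : Orthonormal ℂ b)
    {x : Fin k → H} (hx : Orthonormal ℂ x) {i j : ι} (hij : i ≠ j) {v : ℝ}
    (hv : v ∈ Set.uIcc (projectionDiagonal b x i) (projectionDiagonal b x j)) :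
    ∃ x' : Fin k → H, Orthonormal ℂ x' ∧ projectionDiagonal b x' i = v ∧
      projectionDiagonal b x' j = projectionDiagonal b x i + projectionDiagonal b x j - v ∧
      ∀ a, a ≠ i → a ≠ j → projectionDiagonal b x' a = projectionDiagonal b x a := by
  let p : ℝ → Fin k → ℂ := fun θ l => (Real.cos θ : ℂ) * inner ℂ (b i) (x l) -
    (Real.sin θ : ℂ) * inner ℂ (b j) (x l)
  let q : ℝ → Fin k → ℂ := fun θ l => (Real.sin θ : ℂ) * inner ℂ (b i) (x l) +
    (Real.cos θ : ℂ) * inner ℂ (b j) (x l)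
  -- `y θ` is `x` rotated by `θ` in the plane of `b i` and `b j`. Angle `π / 2` exchanges the two
  -- diagonal entries, so the intermediate value theorem yields `v`.
  let y : ℝ → Fin k → H := fun θ l => x l + ((p θ l - inner ℂ (b i) (x l)) • b i +
    (q θ l - inner ℂ (b j) (x l)) • b j)
  have hii : ∀ a, inner ℂ (b a) (b a) = (1 : ℂ) := fun a => by
    rw [inner_self_eq_norm_sq_to_K, hb.1 a]; simp
  have hyi : ∀ θ l, inner ℂ (b i) (y θ l) = p θ l := fun θ l => by
    simp only [y, inner_add_right, inner_smul_right, hii, hb.2 hij]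
    ring
  have hyj : ∀ θ l, inner ℂ (b j) (y θ l) = q θ l := fun θ l => by
    simp only [y, inner_add_right, inner_smul_right, hii, hb.2 hij.symm]
    ring
  have hya : ∀ θ l a, a ≠ i → a ≠ j → inner ℂ (b a) (y θ l) = inner ℂ (b a) (x l) := by
    intro θ l a hai haj
    simp only [y, inner_add_right, inner_smul_right, hb.2 hai, hb.2 haj]
    ring
  have hcs : ∀ θ : ℝ, (Real.cos θ : ℂ) ^ 2 + (Real.sin θ : ℂ) ^ 2 = 1 := fun θ => by
    norm_cast
    exact Real.cos_sq_add_sin_sq θ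
  have hinner : ∀ θ l l', inner ℂ (y θ l) (y θ l') = inner ℂ (x l) (x l') := by
    intro θ l l'
    have e : inner ℂ (y θ l) (y θ l') = inner ℂ (x l) (y θ l') +
        ((starRingEnd ℂ) (p θ l - inner ℂ (b i) (x l)) * p θ l' +
        (starRingEnd ℂ) (q θ l - inner ℂ (b j) (x l)) * q θ l') := by
      change inner ℂ (x l + ((p θ l - inner ℂ (b i) (x l)) • b i +
        (q θ l - inner ℂ (b j) (x l)) • b j)) (y θ l') = _
      rw [inner_add_left, inner_add_left, inner_smul_left, inner_smul_left, hyi, hyj]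
    rw [e]
    simp only [y, p, q, inner_add_right, inner_smul_right, map_sub, map_add, map_mul,
      Complex.conj_ofReal]
    rw [← inner_conj_symm (x l) (b i), ← inner_conj_symm (x l) (b j)]
    linear_combination (((starRingEnd ℂ) (inner ℂ (b i) (x l)) * inner ℂ (b i) (x l')) +
      (starRingEnd ℂ) (inner ℂ (b j) (x l)) * inner ℂ (b j) (x l')) * hcs θ
  have hy : ∀ θ, Orthonormal ℂ (y θ) := fun θ => by
    classical
    rw [orthonormal_iff_ite] at hx ⊢
    intro l l'
    rw [hinner, hx]
  have hsum : ∀ θ, projectionDiagonal b (y θ) i + projectionDiagonal b (y θ) j =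
      projectionDiagonal b x i + projectionDiagonal b x j := by
    intro θ
    simp only [projectionDiagonal, ← Finset.sum_add_distrib, hyi, hyj]
    refine Finset.sum_congr rfl fun l _ => ?_
    apply Complex.ofReal_injective
    push_cast
    simp only [← Complex.mul_conj', p, q, map_sub, map_add, map_mul, Complex.conj_ofReal]
    linear_combination ((inner ℂ (b i) (x l)) * (starRingEnd ℂ) (inner ℂ (b i) (x l)) +
      (inner ℂ (b j) (x l)) * (starRingEnd ℂ) (inner ℂ (b j) (x l))) * hcs θ
  have hcont : Continuous fun θ => projectionDiagonal b (y θ) i := by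
    simp only [projectionDiagonal, hyi, p]
    fun_prop
  have h0 : projectionDiagonal b (y 0) i = projectionDiagonal b x i := by
    simp [projectionDiagonal, hyi, p]
  have h1 : projectionDiagonal b (y (Real.pi / 2)) i = projectionDiagonal b x j := by
    simp only [projectionDiagonal, hyi, p, Real.cos_pi_div_two, Real.sin_pi_div_two]
    simp
  rw [← h0, ← h1] at hv
  obtain ⟨θ, -, hθ⟩ := intermediate_value_uIcc hcont.continuousOn hv
  refine ⟨y θ, hy θ, hθ, ?_, fun a hai haj => ?_⟩
  · rw [← hsum θ, ← hθ]
    ring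
  · simp only [projectionDiagonal, hya θ _ a hai haj]

/-- The Schur–Horn theorem for projections. -/
theorem exists_orthonormal_projectionDiagonal_eq {b : ι → H} (hb : Orthonormal ℂ b)
    {s : Finset ι} {t : ι → ℝ} (h01 : ∀ a, t a ∈ Set.Icc 0 1) (hs : ∀ a ∉ s, t a = 0)
    (hk : ∑ a ∈ s, t a = k) :
    ∃ x : Fin k → H, Orthonormal ℂ x ∧ projectionDiagonal b x = t := by
  classical
  refine hypersimplex_induction (Q := fun t => ∃ x : Fin k → H, Orthonormal ℂ x ∧
    projectionDiagonal b x = t) ?_ ?_ t h01 hs hk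
  · intro u _ huk
    let e : Fin k ≃ u := (u.equivFinOfCardEq huk).symm
    refine ⟨fun l => b (e l), hb.comp _ (Subtype.val_injective.comp e.injective), ?_⟩
    ext a
    have : ∀ l, ‖(inner ℂ (b a) (b (e l)) : ℂ)‖ ^ 2 = if a = e l then 1 else 0 := by
      intro l
      rw [orthonormal_iff_ite.1 hb]
      split_ifs <;> simp
    simp only [projectionDiagonal, this]
    rw [e.sum_comp fun c : u => if a = c then (1 : ℝ) else 0,
      Finset.sum_coe_sort u fun c => if a = c then (1 : ℝ) else 0, Finset.sum_ite_eq]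
  · rintro t i - j - hij α β hα hβ ⟨x, hx, hxt⟩ ⟨y, hy, hyt⟩
    have aux : ∀ δ, (∃ x : Fin k → H, Orthonormal ℂ x ∧
        projectionDiagonal b x = shiftWeight t i j δ) → t i ∈ Set.uIcc (t i + δ) (t j - δ) →
        ∃ x : Fin k → H, Orthonormal ℂ x ∧ projectionDiagonal b x = t := by
      rintro δ ⟨x, hx, hxt⟩ hδ
      obtain ⟨z, hz, hzi, hzj, hza⟩ := exists_orthonormal_projectionDiagonal_rotate hb hx hij
        (v := t i) (by rwa [hxt, shiftWeight_left, shiftWeight_right t hij])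
      refine ⟨z, hz, funext fun a => ?_⟩
      rcases eq_or_ne a i with rfl | hai
      · exact hzi
      rcases eq_or_ne a j with rfl | haj
      · rw [hzj, hxt, shiftWeight_left, shiftWeight_right t hij]
        ring
      · rw [hza a hai haj, hxt, shiftWeight_of_ne t hai haj]
    -- One shifted point suffices: the one that pushes the two entries further apart, so that `t i`
    -- lies between them.
    rcases le_total (t i) (t j) with h | h
    · exact aux _ ⟨x, hx, hxt⟩ (Set.mem_uIcc.2 (Or.inl ⟨by linarith, by linarith⟩))
    · exact aux _ ⟨y, hy, hyt⟩ (Set.mem_uIcc.2 (Or.inr ⟨by linarith, by linarith⟩))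

end SchurHorn

/-! ### Commuting normal families: the equality of the two sets -/

section Forward
variable {H : Type*} [NormedAddCommGroup H] [InnerProductSpace ℂ H] {ι : Type*} {m : ℕ}

/-- The sums `∑ a, t a • μ a` over the weights `t` in `[0, 1]` of total mass `k`. -/
def weightedSums (k : ℕ) (μ : ι → Fin m → ℂ) : Set (Fin m → ℂ) :=
  {p | ∃ t : ι → ℝ, (∀ a, t a ∈ Set.Icc 0 1) ∧ HasSum t k ∧ HasSum (fun a => t a • μ a) p}

theorem convex_weightedSums (k : ℕ) (μ : ι → Fin m → ℂ) : Convex ℝ (weightedSums k μ) := by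
  rintro p ⟨t, ht, htk, htp⟩ q ⟨r, hr, hrk, hrq⟩ c d hc hd hcd
  refine ⟨fun a => c • t a + d • r a, fun a => convex_Icc 0 1 (ht a) (hr a) hc hd hcd, ?_, ?_⟩
  · have := (htk.const_smul c).add (hrk.const_smul d)
    rwa [← add_smul, hcd, one_smul] at this
  · have := (htp.const_smul c).add (hrq.const_smul d)
    simpa only [add_smul, smul_assoc] using this

theorem weightedSums_exists_finset {k : ℕ} {μ : ι → Fin m → ℂ} {p : Fin m → ℂ}
    (hp : p ∈ weightedSums k μ) :
    ∃ (s : Finset ι) (t : ι → ℝ), (∀ a, t a ∈ Set.Icc 0 1) ∧ (∀ a ∉ s, t a = 0) ∧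
      ∑ a ∈ s, t a = k ∧ ∑ a ∈ s, t a • μ a = p := by
  obtain ⟨t, ht, htk, htp⟩ := hp
  exact exists_finset_sum_eq_and_sum_smul_eq ht htk htp

variable {A : Fin m → H →L[ℂ] H} {μ : ι → Fin m → ℂ}

theorem jointNumericalRange_eq_weightedSums (b : HilbertBasis ι ℂ H)
    (hμ : ∀ a i, A i (b a) = μ a i • b a) (k : ℕ) :
    jointNumericalRange k A = weightedSums k μ := by
  apply Set.Subset.antisymm
  · rintro p ⟨x, hx, hp⟩
    refine ⟨projectionDiagonal b x, fun a => ⟨projectionDiagonal_nonneg b x a,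
      projectionDiagonal_le_one b hx a⟩, hasSum_projectionDiagonal b hx, Pi.hasSum.2 fun i => ?_⟩
    rw [hp i]
    simpa using hasSum_projectionDiagonal_mul b (fun a => hμ a i) x
  · intro p hp
    obtain ⟨s, t, ht, hts, htk, rfl⟩ := weightedSums_exists_finset hp
    obtain ⟨x, hx, hxt⟩ := exists_orthonormal_projectionDiagonal_eq b.orthonormal ht hts htk
    refine ⟨x, hx, fun i => ?_⟩
    have h1 := hasSum_projectionDiagonal_mul b (fun a => hμ a i) x
    rw [hxt] at h1
    have h2 : HasSum (fun a => (t a : ℂ) * μ a i) (∑ a ∈ s, (t a : ℂ) * μ a i) :=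
      hasSum_sum_of_ne_finset_zero fun a ha => by rw [hts a ha, Complex.ofReal_zero, zero_mul]
    rw [h1.unique h2]
    simp

theorem weightedSums_subset_convexHull (b : HilbertBasis ι ℂ H)
    (hμ : ∀ a i, A i (b a) = μ a i • b a) (k : ℕ) :
    weightedSums k μ ⊆ convexHull ℝ (jointEigenvalueSums k A) := by
  intro p hp
  obtain ⟨s, t, ht, hts, htk, rfl⟩ := weightedSums_exists_finset hp
  refine convexHull_mono ?_ (sum_smul_mem_convexHull_of_hypersimplex μ ht hts htk)
  rintro _ ⟨u, hu, rfl⟩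
  let e : Fin k ≃ u := (u.equivFinOfCardEq hu).symm
  refine ⟨fun l => μ (e l), fun l => b (e l), ?_, fun l => ⟨b.orthonormal.ne_zero _, hμ _⟩, ?_⟩
  · exact b.orthonormal.linearIndependent.comp _ (Subtype.val_injective.comp e.injective)
  · rw [e.sum_comp fun a : u => μ a, Finset.sum_coe_sort u μ]

theorem jointNumericalRange_eq_convexHull (b : HilbertBasis ι ℂ H)
    (hμ : ∀ a i, A i (b a) = μ a i • b a) (k : ℕ) :
    jointNumericalRange k A = convexHull ℝ (jointEigenvalueSums k A) := by
  apply Set.Subset.antisymm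
  · rw [jointNumericalRange_eq_weightedSums b hμ]
    exact weightedSums_subset_convexHull b hμ k
  · refine convexHull_min (jointEigenvalueSums_subset_jointNumericalRange k A) ?_
    rw [jointNumericalRange_eq_weightedSums b hμ]
    exact convex_weightedSums k μ

end Forward

/-! ### From the equality back to normality and commutation -/

section Reverse

theorem ContinuousLinearMap.inner_add_star_apply_self {H : Type*} [NormedAddCommGroup H]
    [InnerProductSpace ℂ H] [CompleteSpace H] (C : H →L[ℂ] H) (x : H) :
    (inner ℂ x ((C + star C) x)).re = 2 * (inner ℂ x (C x)).re := by
  rw [_root_.add_apply, inner_add_right, ContinuousLinearMap.star_eq_adjoint,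
    ContinuousLinearMap.adjoint_inner_right, ← inner_conj_symm (C x) x, Complex.add_re,
    Complex.conj_re]
  ring

universe u
variable {H : Type u} [NormedAddCommGroup H] [InnerProductSpace ℂ H] {ι : Type u} {m : ℕ}

/-- Orthonormal vectors at which the Ky Fan maximum over the eigenvalues `≥ r` is attained lie in
the span of the corresponding eigenvectors. -/
theorem inner_eq_zero_of_kyFan_le (b : HilbertBasis ι ℂ H) {B : H →L[ℂ] H} {c : ι → ℝ}
    (hc : ∀ a, B (b a) = (c a : ℂ) • b a) {r : ℝ} {S : Finset ι} (hS : ∀ a, a ∈ S ↔ r ≤ c a)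
    {z : Fin S.card → H} (hz : Orthonormal ℂ z)
    (hmax : ∑ a ∈ S, c a ≤ (∑ l, inner ℂ (z l) (B (z l))).re) {a : ι} (ha : a ∉ S)
    (l : Fin S.card) : inner ℂ (b a) (z l) = 0 := by
  classical
  set D := projectionDiagonal b z with hD
  have h1 : HasSum (fun a => D a * c a) (∑ l, inner ℂ (z l) (B (z l))).re := by
    have := Complex.hasSum_re (hasSum_projectionDiagonal_mul b hc z)
    simpa only [← Complex.ofReal_mul, Complex.ofReal_re] using this
  have h2 : HasSum (fun a => if a ∈ S then c a - r else 0) (∑ a ∈ S, (c a - r)) := by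
    rw [← Finset.sum_congr rfl fun a ha => if_pos (c := a ∈ S) (t := c a - r) (e := 0) ha]
    exact hasSum_sum_of_ne_finset_zero fun a ha => if_neg ha
  have h3 := h2.sub (h1.sub ((hasSum_projectionDiagonal b hz).mul_right r))
  -- Both weights have mass `S.card`, so subtracting `r` from every eigenvalue leaves the gap
  -- unchanged and makes it a sum of nonnegative terms. By `hmax` the sum is at most zero, so every
  -- term vanishes.
  have h4 : ∀ a, 0 ≤ (if a ∈ S then c a - r else 0) - (D a * c a - D a * r) := by
    intro a
    have h5 := projectionDiagonal_nonneg b z a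
    have h6 := projectionDiagonal_le_one b hz a
    rw [← hD] at h5 h6
    split_ifs with h
    · have := (hS a).1 h
      nlinarith
    · have : c a < r := not_le.1 fun h' => h ((hS a).2 h')
      nlinarith
  have h5 := le_hasSum h3 a fun a' _ => h4 a'
  rw [Finset.sum_sub_distrib, Finset.sum_const, nsmul_eq_mul, if_neg ha] at h5
  have h6 : c a < r := not_le.1 fun h' => ha ((hS a).2 h')
  have h7 : D a = 0 := by
    have := projectionDiagonal_nonneg b z a
    rw [← hD] at this
    nlinarith
  have h8 := (Finset.sum_eq_zero_iff_of_nonneg fun _ _ => by positivity).1 h7 l (Finset.mem_univ l)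
  simpa using h8

variable [CompleteSpace H] {A : Fin m → H →L[ℂ] H}

/-- If the joint numerical ranges are the convex hulls of the sums of joint eigenvalues, then a
combination of the operators maps the span of the top eigenvectors of its real part to itself. -/
theorem inner_apply_eq_zero_of_lt
    (h : ∀ k : ℕ, 1 ≤ k → (k : Cardinal) < Module.rank ℂ H →
      jointNumericalRange k A = convexHull ℝ (jointEigenvalueSums k A))
    (w : Fin m → ℂ) {C : H →L[ℂ] H} (hC : C = ∑ i, w i • A i)
    (hCc : IsCompactOperator C)
    (b : HilbertBasis ι ℂ H) {c : ι → ℝ} (hc : ∀ a, (C + star C) (b a) = (c a : ℂ) • b a)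
    {a₀ a₁ : ι} (hpos : 0 < c a₀) (hlt : c a₁ < c a₀) : inner ℂ (b a₁) (C (b a₀)) = 0 := by
  classical
  have hCapp : ∀ x, C x = ∑ i, w i • A i x := fun x => by
    rw [hC, _root_.sum_apply]
    rfl
  have hBc : IsCompactOperator (C + star C) := hCc.add hCc.star_clm
  have hfin : {a | c a₀ ≤ c a}.Finite :=
    (hBc.finite_setOf_le_norm_eigenvalue b.orthonormal hc hpos).subset fun a ha => by
      rw [Set.mem_ofPred_eq] at ha ⊢
      rw [Complex.norm_real, Real.norm_of_nonneg (hpos.le.trans ha)]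
      exact ha
  set S := hfin.toFinset with hSdef
  have hS : ∀ a, a ∈ S ↔ c a₀ ≤ c a := fun a => by rw [hSdef, hfin.mem_toFinset]; rfl
  have h0S : a₀ ∈ S := (hS a₀).2 le_rfl
  have h1S : a₁ ∉ S := fun h => absurd ((hS a₁).1 h) (not_le.2 hlt)
  -- The index `a₁` outside `S` is what makes the range `k < dim` sufficient.
  have hrank : (S.card : Cardinal) < Module.rank ℂ H := by
    have := (b.orthonormal.linearIndependent.comp (Subtype.val : ↥(insert a₁ S) → ι)
      Subtype.val_injective).cardinal_le_rank
    rw [Cardinal.mk_coe_finset, Finset.card_insert_of_notMem h1S] at this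
    exact lt_of_lt_of_le (by exact_mod_cast Nat.lt_succ_self _) this
  have heq := h S.card (Finset.card_pos.2 ⟨a₀, h0S⟩) hrank
  let e : Fin S.card ≃ S := (S.equivFinOfCardEq rfl).symm
  have hx : Orthonormal ℂ fun l => b (e l) :=
    b.orthonormal.comp _ (Subtype.val_injective.comp e.injective)
  let f : (Fin m → ℂ) →ₗ[ℝ] ℝ := ∑ i, Complex.reLm ∘ₗ
    (LinearMap.mul ℝ ℂ (w i)) ∘ₗ (LinearMap.proj i : (Fin m → ℂ) →ₗ[ℝ] ℂ)
  have hf : ∀ p, f p = ∑ i, (w i * p i).re := fun p => by simp [f, LinearMap.sum_apply]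
  have hfx : ∀ x : Fin S.card → H, 2 * f (fun i => ∑ l, inner ℂ (x l) (A i (x l))) =
      (∑ l, inner ℂ (x l) ((C + star C) (x l))).re := by
    intro x
    rw [hf, Complex.re_sum, Finset.sum_congr rfl fun l _ =>
      ContinuousLinearMap.inner_add_star_apply_self C (x l), ← Finset.mul_sum, ← Complex.re_sum,
      ← Complex.re_sum]
    congr 2
    simp only [hCapp, inner_sum, inner_smul_right, Finset.mul_sum]
    exact Finset.sum_comm
  have hmem : (fun i => ∑ l, inner ℂ (b (e l)) (A i (b (e l)))) ∈
      convexHull ℝ (jointEigenvalueSums S.card A) := by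
    rw [← heq]
    exact ⟨_, hx, fun i => rfl⟩
  -- Some generator of the hull does at least as well under `f` as the top eigenvectors of `C + star
  -- C`.
  obtain ⟨q, ⟨μ, y, hy, hμ, rfl⟩, hle⟩ := (f.convexOn convex_univ).exists_ge_of_mem_convexHull
    (Set.subset_univ _) hmem
  obtain ⟨z, hz, hspan, hzμ⟩ := exists_orthonormal_of_common_eigenvectors hy fun l => (hμ l).2
  have hq : ∑ l, μ l = fun i => ∑ l, inner ℂ (z l) (A i (z l)) := by
    ext i
    simp [hzμ]
  have hmax : ∑ a ∈ S, c a ≤ (∑ l, inner ℂ (z l) ((C + star C) (z l))).re := by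
    rw [← hfx, ← hq]
    refine le_trans (le_of_eq ?_) (mul_le_mul_of_nonneg_left hle zero_le_two)
    rw [hfx, Complex.re_sum, ← Finset.sum_coe_sort S, ← e.sum_comp]
    refine Finset.sum_congr rfl fun l _ => ?_
    rw [hc, inner_smul_right, inner_self_eq_norm_sq_to_K, b.orthonormal.1]
    simp
  have hzS : ∀ l, z l ∈ Submodule.span ℂ (Set.range fun a : S => b a) := by
    intro l
    have h2 : HasSum (fun a => b.repr (z l) a • b a) (∑ a ∈ S, b.repr (z l) a • b a) :=
      hasSum_sum_of_ne_finset_zero fun a ha => by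
        rw [b.repr_apply_apply, inner_eq_zero_of_kyFan_le b hc hS hz hmax ha l, zero_smul]
    rw [(b.hasSum_repr (z l)).unique h2]
    exact Submodule.sum_mem _ fun a ha =>
      Submodule.smul_mem _ _ (Submodule.subset_span ⟨⟨a, ha⟩, rfl⟩)
  have hbS : LinearIndependent ℂ fun a : S => b a :=
    b.orthonormal.linearIndependent.comp _ Subtype.val_injective
  have hspanS : Submodule.span ℂ (Set.range y) = Submodule.span ℂ (Set.range fun a : S => b a) := by
    rw [← hspan]
    have : FiniteDimensional ℂ (Submodule.span ℂ (Set.range fun a : S => b a)) :=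
      FiniteDimensional.span_of_finite ℂ (Set.finite_range _)
    refine Submodule.eq_of_le_of_finrank_eq (Submodule.span_le.2 ?_) ?_
    · rintro _ ⟨l, rfl⟩
      exact hzS l
    · rw [finrank_span_eq_card hz.linearIndependent, finrank_span_eq_card hbS]
      simp
  have hb0 : b a₀ ∈ Submodule.span ℂ (Set.range y) := by
    rw [hspanS]
    exact Submodule.subset_span ⟨⟨a₀, h0S⟩, rfl⟩
  have hCy : ∀ v ∈ Submodule.span ℂ (Set.range y), C v ∈ Submodule.span ℂ (Set.range y) := by
    intro v hv
    induction hv using Submodule.span_induction with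
    | mem v hv =>
      obtain ⟨l, rfl⟩ := hv
      rw [hCapp]
      refine Submodule.sum_mem _ fun i _ => ?_
      rw [(hμ l).2 i]
      exact Submodule.smul_mem _ _ (Submodule.smul_mem _ _ (Submodule.subset_span ⟨l, rfl⟩))
    | zero => simp
    | add u v _ _ hu hv =>
      rw [map_add]
      exact add_mem hu hv
    | smul r v _ hv =>
      rw [map_smul]
      exact Submodule.smul_mem _ _ hv
  have hfinal := hCy _ hb0
  rw [hspanS] at hfinal
  generalize C (b a₀) = v at hfinal
  induction hfinal using Submodule.span_induction with
  | mem v hv =>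
    obtain ⟨a, rfl⟩ := hv
    exact b.orthonormal.2 fun h' => h1S (h' ▸ a.2)
  | zero => simp
  | add u v _ _ hu hv => rw [inner_add_right, hu, hv, add_zero]
  | smul r v _ hv => rw [inner_smul_right, hv, mul_zero]

/-- In an eigenbasis of `C + star C`, the matrix of `C` has no entries between different
eigenvalues; hence `C` commutes with `C + star C`, and so with `star C`. -/
theorem isStarNormal_sum_smul
    (h : ∀ k : ℕ, 1 ≤ k → (k : Cardinal) < Module.rank ℂ H →
      jointNumericalRange k A = convexHull ℝ (jointEigenvalueSums k A))
    (hA : ∀ i, IsCompactOperator (A i)) (w : Fin m → ℂ) : IsStarNormal (∑ i, w i • A i) := by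
  set C := ∑ i, w i • A i with hC
  have hCc : IsCompactOperator C := isCompactOperator_sum_smul hA w
  have hs := isSymmetric_add_star C
  obtain ⟨s, b, hb⟩ := exists_hilbertBasis_common_eigenvectors (ι := Unit)
    (T := fun _ => C + star C) (fun _ => hCc.add hCc.star_clm) (fun _ => hs)
    (fun _ _ => Commute.refl _)
  choose d hd using hb ()
  have hsymm : ∀ u v, inner ℂ ((C + star C) u) v = inner ℂ u ((C + star C) v) := hs
  have hbb : ∀ a, inner ℂ (b a) (b a) = (1 : ℂ) := fun a => by
    rw [inner_self_eq_norm_sq_to_K, b.orthonormal.1]; simp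
  obtain ⟨c, hc⟩ : ∃ c : s → ℝ, ∀ a, (C + star C) (b a) = (c a : ℂ) • b a := by
    refine ⟨fun a => (d a).re, fun a => ?_⟩
    have := hsymm (b a) (b a)
    rw [hd, inner_smul_left, inner_smul_right, hbb, mul_one, mul_one] at this
    rw [hd, Complex.conj_eq_iff_re.1 this]
  have key₁ : ∀ a a', 0 < c a → c a' < c a → inner ℂ (b a') (C (b a)) = 0 := fun a a' h0 h1 =>
    inner_apply_eq_zero_of_lt h w hC hCc b hc h0 h1
  have key₂ : ∀ a a', c a < 0 → c a < c a' → inner ℂ (b a') (C (b a)) = 0 := fun a a' h0 h1 => by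
    have h2 := inner_apply_eq_zero_of_lt h (-w) (C := -C)
      (by rw [hC, ← Finset.sum_neg_distrib]; simp) hCc.neg b (c := -c)
      (fun a => by
        rw [star_neg, ← neg_add, _root_.neg_apply, hc]
        simp)
      (a₀ := a) (a₁ := a') (by simpa using h0) (by simpa using h1)
    simpa using h2
  -- Off-diagonal entries of `C + star C` vanish, so a zero entry of `C` forces the transposed one
  -- to be zero.
  have anti : ∀ a a', a ≠ a' → inner ℂ (b a) (C (b a')) = 0 → inner ℂ (b a') (C (b a)) = 0 := by
    intro a a' hne h0
    have h1 : inner ℂ (b a') ((C + star C) (b a)) = 0 := by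
      rw [hc, inner_smul_right, b.orthonormal.2 hne.symm, mul_zero]
    rw [_root_.add_apply, inner_add_right, ContinuousLinearMap.star_eq_adjoint,
      ContinuousLinearMap.adjoint_inner_right, ← inner_conj_symm (C (b a')), h0, map_zero,
      add_zero] at h1
    exact h1
  have key : ∀ a a', (c a' : ℂ) * inner ℂ (b a') (C (b a)) = c a * inner ℂ (b a') (C (b a)) := by
    intro a a'
    -- Of two distinct eigenvalues, the larger is positive or the smaller is negative, so the
    -- eigenvalue `0` needs no separate treatment.
    rcases lt_trichotomy (c a') (c a) with hlt | heq | hlt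
    · have hne : a' ≠ a := fun h => hlt.ne (congrArg c h)
      have : inner ℂ (b a') (C (b a)) = 0 := by
        rcases lt_or_ge 0 (c a) with h0 | h0
        · exact key₁ a a' h0 hlt
        · exact anti a a' hne.symm (key₂ a' a (hlt.trans_le h0) hlt)
      rw [this, mul_zero, mul_zero]
    · rw [heq]
    · have hne : a ≠ a' := fun h => hlt.ne (congrArg c h)
      have : inner ℂ (b a') (C (b a)) = 0 := by
        rcases lt_or_ge 0 (c a') with h0 | h0
        · exact anti a a' hne (key₁ a' a h0 hlt)
        · exact key₂ a a' (hlt.trans_le h0) hlt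
      rw [this, mul_zero, mul_zero]
  have hcomm : Commute (C + star C) C := by
    refine ContinuousLinearMap.ext_on (s := Set.range b) ?_ ?_
    · exact Submodule.dense_iff_topologicalClosure_eq_top.2 b.dense_span
    · rintro _ ⟨a, rfl⟩
      apply b.repr.injective
      ext a'
      rw [b.repr_apply_apply, b.repr_apply_apply, mul_apply_eq_comp, mul_apply_eq_comp,
        ← hsymm, hc,
        hc, inner_smul_left, map_smul, inner_smul_right, Complex.conj_ofReal]
      exact key a a'
  refine ⟨?_⟩
  have := hcomm.sub_left (Commute.refl C)
  rwa [add_sub_cancel_left] at this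

/-- Polarisation: the two hypotheses on sums give `x*y + y*x = xy* + yx*` and `x*y - y*x = yx* -
xy*`; add them. -/
theorem commute_star_of_isStarNormal_add {R : Type*} [Ring R] [StarRing R] [Algebra ℂ R]
    [StarModule ℂ R] {x y : R} (hx : IsStarNormal x) (hy : IsStarNormal y)
    (h₁ : IsStarNormal (x + y)) (h₂ : IsStarNormal (x + Complex.I • y)) : Commute (star x) y := by
  have hx := hx.star_comm_self.eq
  have hy := hy.star_comm_self.eq
  have h₁ := h₁.star_comm_self.eq
  have h₂ := congrArg (Complex.I • ·) h₂.star_comm_self.eq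
  simp only [star_add, star_smul, add_mul, mul_add, smul_mul_assoc, mul_smul_comm, smul_add,
    smul_smul, Complex.star_def, Complex.conj_I, mul_neg, neg_mul, Complex.I_mul_I, neg_neg,
    mul_one, hx, hy] at h₁ h₂
  change star x * y = y * star x
  linear_combination (norm := module) (1 / 2 : ℂ) • h₁ - (1 / 2 : ℂ) • h₂

theorem isCommutingNormalFamily_of_jointNumericalRange_eq
    (h : ∀ k : ℕ, 1 ≤ k → (k : Cardinal) < Module.rank ℂ H →
      jointNumericalRange k A = convexHull ℝ (jointEigenvalueSums k A))
    (hA : ∀ i, IsCompactOperator (A i)) : IsCommutingNormalFamily A := by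
  have hN := isStarNormal_sum_smul h hA
  have hsingle : ∀ (i : Fin m) (c : ℂ), ∑ l, (Pi.single i c : Fin m → ℂ) l • A l = c • A i := by
    intro i c
    rw [Finset.sum_eq_single i (fun l _ hl => by rw [Pi.single_eq_of_ne hl, zero_smul])
      (fun hi => absurd (Finset.mem_univ i) hi), Pi.single_eq_same]
  have h1 : ∀ i, IsStarNormal (A i) := fun i => by
    simpa only [hsingle, one_smul] using hN (Pi.single i 1)
  have h2 : ∀ i j (c : ℂ), IsStarNormal (A i + c • A j) := fun i j c => by
    have := hN (Pi.single i 1 + Pi.single j c)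
    simpa only [Pi.add_apply, add_smul, Finset.sum_add_distrib, hsingle, one_smul] using this
  refine ⟨h1, fun i j => ?_⟩
  have h3 := commute_star_of_isStarNormal_add (h1 i) (h1 j) (by simpa using h2 i j 1)
    (h2 i j Complex.I)
  have h4 : IsStarNormal (star (A i)) := (h1 i).star
  -- Fuglede's theorem again, for the normal operator `star (A i)`.
  simpa using h4.commute_star_left h3

end Reverse

theorem theorem3p1 {H : Type*} [NormedAddCommGroup H] [InnerProductSpace ℂ H] [CompleteSpace H]
    {m : ℕ} (A : Fin m → H →L[ℂ] H) (hA : ∀ i, IsCompactOperator (A i)) :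
    (IsCommutingNormalFamily A ↔
      ∀ k : ℕ, 1 ≤ k → jointNumericalRange k A = convexHull ℝ (jointEigenvalueSums k A)) ∧
    (IsCommutingNormalFamily A ↔
      ∀ k : ℕ, 1 ≤ k → (k : Cardinal) < Module.rank ℂ H →
        jointNumericalRange k A = convexHull ℝ (jointEigenvalueSums k A)) := by
  have forward : IsCommutingNormalFamily A → ∀ k : ℕ,
      jointNumericalRange k A = convexHull ℝ (jointEigenvalueSums k A) := by
    intro h k
    obtain ⟨w, b, μ, hμ⟩ := h.exists_hilbertBasis hA
    exact jointNumericalRange_eq_convexHull b hμ k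
  exact ⟨⟨fun h k _ => forward h k,
      fun h => isCommutingNormalFamily_of_jointNumericalRange_eq (fun k hk _ => h k hk) hA⟩,
    ⟨fun h k _ _ => forward h k,
      fun h => isCommutingNormalFamily_of_jointNumericalRange_eq h hA⟩⟩
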